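/- Let $\mathcal X$ be a measurable space, let $\mathcal D$ be the set of probability distributions on $\mathcal X$, and let $\mathbb P,\mathbb Q\in\mathcal D$ and $\varepsilon>0$. A mechanism on datasets of size $n$ is a Markov kernel $\mathcal M$ from $\mathcal X^n$ to some measurable space $\mathcal O$; it is $\varepsilon$-differentially private ($\varepsilon$-DP) if $\Pr[\mathcal M(x)\in S]\le e^{\varepsilon}\Pr[\mathcal M(x')\in S]$ for all $x,x'\in\mathcal X^n$ differing in exactly one entry and all measurable $S\subseteq\mathcal O$. Write $\mathcal M(R^n)$ for the law of the output of $\mathcal M$ when its input is an i.i.d. sample of size $n$ from $R$. Let $\mathrm{KL}(\cdot\|\cdot)$ be the Kullback–Leibler divergence (equal to $+\infty$ in the absence of absolute continuity) and $\mathrm{TV}(Q',\mathbb Q)=\sup_A|Q'(A)-\mathbb Q(A)|$, the supremum over measurable sets. Then the limit on the left exists and $$\lim_{n\to\infty}\ \sup_{\mathcal M\ \varepsilon\text{-DP}}\frac{\mathrm{KL}\big(\mathcal M(\mathbb Q^n)\,\|\,\mathcal M(\mathbb P^n)\big)}{n}\;=\;\inf_{Q'\in\mathcal D}\Big\{\mathrm{KL}(Q'\|\mathbb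 P)+\varepsilon\,\mathrm{TV}(Q',\mathbb Q)\Big\},$$ where the supremum is over all $\varepsilon$-DP mechanisms on datasets of size $n$, with arbitrary output space. Moreover, the same value is the optimal $\varepsilon$-DP e-power rate $$\mathfrak R_\varepsilon(\mathbb Q\|\mathbb P)=\lim_{n\to\infty}\ \sup_{E}\ \frac{\mathbb E^{\mathbb Q^n}[\log E]}{n},$$ and this limit exists, where the supremum is over all $\varepsilon$-DP e-variables $E=\mathcal M(X)$ for $\mathbb P$ on datasets of size $n$: $\mathcal M$ is an $\varepsilon$-DP mechanism with values in $[0,\infty)$ and $\mathbb E^{\mathbb P^n}[\mathcal M(X)]\le 1$, the expectations being over both the data and the randomness of $\mathcal M$, with $\log 0=-\infty$. -/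

import Mathlib

open MeasureTheory ProbabilityTheory Filter Topology
open scoped ENNReal NNReal

universe u v

namespace DPDuality

noncomputable section

/-- Two datasets of size `n` are neighbours when they differ in exactly one entry. -/
def Neighbors {X : Type u} {n : ℕ} (x x' : Fin n → X) : Prop :=
  ∃! i, x i ≠ x' i

/-- `ε`-differential privacy of a randomized algorithm on datasets of size `n`, given by the kernel
of its output distributions: `Pr[M(x) ∈ S] ≤ e^ε Pr[M(x') ∈ S]` for all neighbouring datasets and
all events `S`. -/
def IsDP {X : Type u} [MeasurableSpace X] {O : Type v} [MeasurableSpace O] {n : ℕ}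
    (ε : ℝ) (M : Kernel (Fin n → X) O) : Prop :=
  ∀ x x' : Fin n → X, Neighbors x x' → ∀ S : Set O, MeasurableSet S →
    M x S ≤ ENNReal.ofReal (Real.exp ε) * M x' S

/-- The law `P^n` of an i.i.d. sample of size `n` from `P`. -/
def iid {X : Type u} [MeasurableSpace X] (n : ℕ) (P : Measure X) : Measure (Fin n → X) :=
  Measure.pi fun _ => P

/-- The distribution `M(P^n)` of the output of `M` on an i.i.d. sample of size `n` from `P`. -/
def outputLaw {X : Type u} [MeasurableSpace X] {O : Type v} [MeasurableSpace O] {n : ℕ}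
    (M : Kernel (Fin n → X) O) (P : Measure X) : Measure O :=
  (iid n P).bind M

/-- Total variation distance `sup_A |μ(A) - ν(A)|`, the supremum over measurable sets. -/
def tvDist {X : Type u} [MeasurableSpace X] (μ ν : Measure X) : ℝ≥0∞ :=
  ⨆ (A : Set X) (_ : MeasurableSet A), ENNReal.ofReal |μ.real A - ν.real A|

/-- `sup_M KL(M(Q^n) ‖ M(P^n)) / n`, the supremum over all `ε`-DP mechanisms `M` on datasets of
size `n`, with values in an arbitrary measurable space `O`. -/
def maxKLRate {X : Type u} [MeasurableSpace X] (ε : ℝ) (Q P : Measure X) (n : ℕ) : ℝ≥0∞ :=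
  ⨆ (O : Type v) (_ : MeasurableSpace O) (M : Kernel (Fin n → X) O) (_ : IsMarkovKernel M)
    (_ : IsDP ε M),
    InformationTheory.klDiv (outputLaw M Q) (outputLaw M P) / (n : ℝ≥0∞)

/-- The extended-real expectation `𝔼[log E]` of a non-negative random variable `E` with law `ν`:
the integral of the positive part minus the integral of the negative part, with `log 0 = -∞`. -/
def expLog (ν : Measure ℝ≥0) : EReal :=
  ((∫⁻ y, (ENNReal.log (y : ℝ≥0∞)).toENNReal ∂ν : ℝ≥0∞) : EReal) -
    ((∫⁻ y, (-ENNReal.log (y : ℝ≥0∞)).toENNReal ∂ν : ℝ≥0∞) : EReal)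

/-- A randomized algorithm with non-negative output is an `ε`-DP e-variable for `P` when it is
`ε`-DP and `𝔼[M(X)] ≤ 1` for `X ∼ P^n`. -/
def IsDPEVariable {X : Type u} [MeasurableSpace X] {n : ℕ} (ε : ℝ) (P : Measure X)
    (M : Kernel (Fin n → X) ℝ≥0) : Prop :=
  IsMarkovKernel M ∧ IsDP ε M ∧ ∫⁻ y, (y : ℝ≥0∞) ∂(outputLaw M P) ≤ 1

/-- `sup_E 𝔼^{Q^n}[log E] / n`, the supremum over all `ε`-DP e-variables `E` for `P` on datasets of
size `n`. -/
def maxEPowerRate {X : Type u} [MeasurableSpace X] (ε : ℝ) (Q P : Measure X) (n : ℕ) : EReal :=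
  ⨆ (M : Kernel (Fin n → X) ℝ≥0) (_ : IsDPEVariable ε P M),
    expLog (outputLaw M Q) / (n : EReal)

/-- `inf_{Q'} KL(Q' ‖ P) + ε TV(Q', Q)`, the infimum over all probability distributions `Q'`. -/
def dualValue {X : Type u} [MeasurableSpace X] (ε : ℝ) (Q P : Measure X) : ℝ≥0∞ :=
  ⨅ (Q' : Measure X) (_ : IsProbabilityMeasure Q'),
    InformationTheory.klDiv Q' P + ENNReal.ofReal ε * tvDist Q' Q

end

end DPDuality

namespace DPDuality

/-! ### Variational bounds for relative entropy and total variation -/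

section Divergences

variable {X : Type*} [MeasurableSpace X]

/-! Write D for the dual value. Both quantities are governed by one inequality: for an ε-DP
mechanism M and bounded f on the output space, `∫ f dM(Q^n) ≤ log ∫ e^f dM(P^n) + n D`
(`IsDP.integral_outputLaw_le`).

Converse. Privacy says exactly what is needed of `g x = log ∫ e^f dM(x)`: changing one entry moves
it by at most ε. For one sample, a function h of oscillation at most ε satisfies `∫ h dQ ≤ ∫ h dQ' +
ε TV ≤ log ∫ e^h dP + KL(Q'‖P) + ε TV` for every Q'. Integrating out one coordinate at a time
preserves the oscillation bound and costs D per coordinate. Taking f to be the log-likelihood ratio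
bounds KL; taking truncations of the logarithm bounds the e-power.

Achievability. Clip dQ/dP to `[c, c e^ε]`, with c making the result a probability density w, and put
`h = log (w / c)`, with values in [0, ε]. The measure with density w shows that D is at most `V = ∫
h dQ - log ∫ e^h dP` (`exists_dualValue_le`). The sum of the h(x_i) has sensitivity ε, so adding
standard Laplace noise is ε-DP. Clipped to [0, nε], normalised and exponentiated, it is an
e-variable of power at least `n V - O(log n)` (`exists_isDP_integral_ge`), and the same test
function bounds KL from below. -/

theorem ofReal_integral_sub_log_integral_exp_le_klDiv (μ ν : Measure X)
    [IsProbabilityMeasure μ] [IsProbabilityMeasure ν] {f : X → ℝ} (hf : Integrable f μ)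
    (hexp : Integrable (fun x => Real.exp (f x)) ν) :
    ENNReal.ofReal (∫ x, f x ∂μ - Real.log (∫ x, Real.exp (f x) ∂ν)) ≤
      InformationTheory.klDiv μ ν := by
  by_cases h : InformationTheory.klDiv μ ν = ∞
  · simp [h]
  obtain ⟨hac, hint⟩ := InformationTheory.klDiv_ne_top_iff.1 h
  rw [← ENNReal.ofReal_toReal h, InformationTheory.toReal_klDiv_of_measure_eq hac (by simp)]
  apply ENNReal.ofReal_le_ofReal
  -- Gibbs' inequality against ν tilted by f: the nonnegative divergence from the tilted measure is
  -- the original one minus `∫ f dμ - log ∫ e^f dν`.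
  have := isProbabilityMeasure_tilted hexp
  have hac' : μ ≪ ν.tilted f := hac.trans (absolutelyContinuous_tilted hexp)
  have h1 := InformationTheory.integral_llr_add_sub_measure_univ_nonneg hac'
    (integrable_llr_tilted_right hac hf hint hexp)
  have h2 := integral_llr_tilted_right hac hf hexp hint
  simp only [probReal_univ] at h1
  linarith

/-- The two-sided domination makes the log-likelihood ratio essentially bounded, so it is itself an
admissible test function, and its exponential has ν-integral one. -/
theorem klDiv_le_of_forall_bounded (μ ν : Measure X)
    [IsProbabilityMeasure μ] [IsProbabilityMeasure ν] {a D : ℝ}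
    (hμν : μ ≤ ENNReal.ofReal (Real.exp a) • ν) (hνμ : ν ≤ ENNReal.ofReal (Real.exp a) • μ)
    (hD : ∀ f : X → ℝ, Measurable f → (∃ C, ∀ x, |f x| ≤ C) →
      ∫ x, f x ∂μ ≤ Real.log (∫ x, Real.exp (f x) ∂ν) + D) :
    InformationTheory.klDiv μ ν ≤ ENNReal.ofReal D := by
  have hac : μ ≪ ν := Measure.absolutelyContinuous_of_le_smul hμν
  have hac' : ν ≪ μ := Measure.absolutelyContinuous_of_le_smul hνμ
  have hup : ∀ᵐ x ∂ν, μ.rnDeriv ν x ≤ ENNReal.ofReal (Real.exp a) := by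
    apply ae_le_of_forall_setLIntegral_le_of_sigmaFinite (Measure.measurable_rnDeriv _ _)
    intro s hs _
    rw [Measure.setLIntegral_rnDeriv hac]
    simpa using hμν s
  have hlo : ∀ᵐ x ∂ν, 1 ≤ ENNReal.ofReal (Real.exp a) * μ.rnDeriv ν x := by
    apply ae_le_of_forall_setLIntegral_le_of_sigmaFinite measurable_const
    intro s hs _
    rw [lintegral_const_mul _ (Measure.measurable_rnDeriv _ _), Measure.setLIntegral_rnDeriv hac]
    simpa using hνμ s
  have hb : ∀ᵐ x ∂ν, |llr μ ν x| ≤ a ∧ Real.exp (llr μ ν x) = (μ.rnDeriv ν x).toReal := by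
    filter_upwards [hup, hlo] with x h1 h2
    have hne : μ.rnDeriv ν x ≠ ∞ := ne_top_of_le_ne_top ENNReal.ofReal_ne_top h1
    have h1' : (μ.rnDeriv ν x).toReal ≤ Real.exp a :=
      (ENNReal.toReal_le_of_le_ofReal (Real.exp_pos a).le h1)
    have h2' : 1 ≤ Real.exp a * (μ.rnDeriv ν x).toReal := by
      have := ENNReal.toReal_mono (by finiteness) h2
      simpa [ENNReal.toReal_mul, (Real.exp_pos a).le] using this
    have hpos : 0 < (μ.rnDeriv ν x).toReal := by
      by_contra hcon
      have : (μ.rnDeriv ν x).toReal = 0 := le_antisymm (not_lt.1 hcon) ENNReal.toReal_nonneg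
      rw [this] at h2'
      norm_num at h2'
    refine ⟨abs_le.2 ⟨?_, ?_⟩, ?_⟩
    · rw [llr, Real.le_log_iff_exp_le hpos, Real.exp_neg, inv_le_iff_one_le_mul₀ (Real.exp_pos a)]
      linarith
    · rwa [llr, Real.log_le_iff_le_exp hpos]
    · rw [llr, Real.exp_log hpos]
  -- Truncation turns the almost sure bound into one valid everywhere; `|a|` is used because no sign
  -- of `a` is assumed.
  set f : X → ℝ := fun x => max (-|a|) (min |a| (llr μ ν x)) with hf_def
  have hfm : Measurable f := by fun_prop
  have hfb : ∀ x, |f x| ≤ |a| := fun x => abs_le.2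
    ⟨le_max_left _ _, max_le (by linarith [abs_nonneg a]) (min_le_left _ _)⟩
  have hfeq : ∀ᵐ x ∂ν, f x = llr μ ν x := by
    filter_upwards [hb] with x hx
    have := abs_le.1 (hx.1.trans (le_abs_self a))
    simp only [hf_def]
    rw [min_eq_right this.2, max_eq_right this.1]
  have hint : Integrable (llr μ ν) μ :=
    (Integrable.of_bound hfm.aestronglyMeasurable |a| (ae_of_all _ hfb)).congr (hac.ae_le hfeq)
  have h1 : ∫ x, Real.exp (f x) ∂ν = 1 := by
    calc ∫ x, Real.exp (f x) ∂ν = ∫ x, (μ.rnDeriv ν x).toReal ∂ν := by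
          apply integral_congr_ae
          filter_upwards [hfeq, hb] with x hx hx'
          rw [hx, hx'.2]
      _ = 1 := by rw [Measure.integral_toReal_rnDeriv hac]; simp
  have h2 := hD f hfm ⟨_, hfb⟩
  rw [h1, Real.log_one, zero_add, integral_congr_ae (hac.ae_le hfeq)] at h2
  rw [InformationTheory.klDiv_of_ac_of_integrable hac hint]
  apply ENNReal.ofReal_le_ofReal
  simpa using h2

theorem tvDist_le_one (μ ν : Measure X) [IsProbabilityMeasure μ] [IsProbabilityMeasure ν] :
    tvDist μ ν ≤ 1 := by
  refine iSup₂_le fun A _ => ?_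
  rw [← ENNReal.ofReal_one]
  apply ENNReal.ofReal_le_ofReal
  have h1 := measureReal_nonneg (μ := μ) (s := A)
  have h2 := measureReal_nonneg (μ := ν) (s := A)
  have h3 := measureReal_le_one (μ := μ) (s := A)
  have h4 := measureReal_le_one (μ := ν) (s := A)
  rw [abs_le]
  constructor <;> linarith

theorem tvDist_ne_top (μ ν : Measure X) [IsProbabilityMeasure μ] [IsProbabilityMeasure ν] :
    tvDist μ ν ≠ ∞ :=
  ne_top_of_le_ne_top ENNReal.one_ne_top (tvDist_le_one μ ν)

theorem abs_measureReal_sub_le_tvDist (μ ν : Measure X) [IsProbabilityMeasure μ]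
    [IsProbabilityMeasure ν] {A : Set X} (hA : MeasurableSet A) :
    |μ.real A - ν.real A| ≤ (tvDist μ ν).toReal := by
  rw [← ENNReal.ofReal_le_iff_le_toReal (tvDist_ne_top μ ν)]
  exact le_iSup₂ (f := fun (A : Set X) (_ : MeasurableSet A) =>
    ENNReal.ofReal |μ.real A - ν.real A|) A hA

/-- Comparing `a + ε - h` on a Hahn set s and `h - a` off it, both nonnegative, leaves exactly `ε (ν
s - μ s)`. -/
theorem integral_sub_integral_le_mul_tvDist (μ ν : Measure X) [IsProbabilityMeasure μ]
    [IsProbabilityMeasure ν] {h : X → ℝ} (hm : Measurable h) {a ε : ℝ}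
    (h0 : ∀ x, a ≤ h x) (h1 : ∀ x, h x ≤ a + ε) :
    ∫ x, h x ∂ν - ∫ x, h x ∂μ ≤ ε * (tvDist μ ν).toReal := by
  have hint (ρ : Measure X) [IsFiniteMeasure ρ] : Integrable h ρ :=
    Integrable.of_bound hm.aestronglyMeasurable (max |a| |a + ε|)
      (ae_of_all _ fun x => abs_le_max_abs_abs (h0 x) (h1 x))
  have hε : 0 ≤ ε := by
    obtain ⟨x⟩ := (nonempty_of_isProbabilityMeasure μ)
    linarith [h0 x, h1 x]
  obtain ⟨s, hs, hle, hge⟩ := exists_isHahnDecomposition μ ν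
  -- `μ ≤ ν` on `s` and `ν ≤ μ` on the complement
  have e1 : ∫ x in s, (a + ε - h x) ∂μ ≤ ∫ x in s, (a + ε - h x) ∂ν :=
    integral_mono_measure hle (ae_of_all _ fun x => by simpa using h1 x)
      ((integrable_const _).sub (hint _))
  have e2 : ∫ x in sᶜ, (h x - a) ∂ν ≤ ∫ x in sᶜ, (h x - a) ∂μ :=
    integral_mono_measure hge (ae_of_all _ fun x => by simpa using h0 x)
      ((hint _).sub (integrable_const _))
  rw [integral_sub (integrable_const _) (hint _), integral_sub (integrable_const _) (hint _)] at e1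
  rw [integral_sub (hint _) (integrable_const _), integral_sub (hint _) (integrable_const _)] at e2
  simp only [integral_const, measureReal_restrict_apply_univ, smul_eq_mul] at e1 e2
  rw [← integral_add_compl hs (hint ν), ← integral_add_compl hs (hint μ)]
  have h3 := abs_measureReal_sub_le_tvDist μ ν hs
  have h4 := neg_abs_le (μ.real s - ν.real s)
  have h5 : ε * (ν.real s - μ.real s) ≤ ε * (tvDist μ ν).toReal :=
    mul_le_mul_of_nonneg_left (by linarith) hε
  rw [probReal_compl_eq_one_sub hs, probReal_compl_eq_one_sub hs] at e2
  linarith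

end Divergences

/-! ### Converse: tensorization and the privacy constraint -/

section Converse

variable {X : Type*} [MeasurableSpace X]

instance isProbabilityMeasure_iid (n : ℕ) (P : Measure X) [IsProbabilityMeasure P] :
    IsProbabilityMeasure (iid n P) := by
  unfold iid; infer_instance

instance isProbabilityMeasure_outputLaw {O : Type*} [MeasurableSpace O] {n : ℕ}
    (M : Kernel (Fin n → X) O) [IsMarkovKernel M] (P : Measure X) [IsProbabilityMeasure P] :
    IsProbabilityMeasure (outputLaw M P) := by
  unfold outputLaw; infer_instance

theorem dualValue_ne_top (P Q : Measure X) [IsProbabilityMeasure P] [IsProbabilityMeasure Q]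
    (ε : ℝ) : dualValue ε Q P ≠ ∞ := by
  refine ne_top_of_le_ne_top ?_ (iInf₂_le P ‹IsProbabilityMeasure P›)
  rw [InformationTheory.klDiv_self, zero_add]
  exact ENNReal.mul_ne_top ENNReal.ofReal_ne_top (tvDist_ne_top P Q)

theorem integrable_of_measurable_of_abs_le {f : X → ℝ} (hf : Measurable f)
    (hb : ∃ C, ∀ x, |f x| ≤ C) (μ : Measure X) [IsFiniteMeasure μ] : Integrable f μ := by
  obtain ⟨C, hC⟩ := hb
  exact Integrable.of_bound hf.aestronglyMeasurable C (ae_of_all _ hC)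

omit [MeasurableSpace X] in
theorem exists_abs_exp_le {f : X → ℝ} (hb : ∃ C, ∀ x, |f x| ≤ C) :
    ∃ C, ∀ x, |Real.exp (f x)| ≤ C := by
  obtain ⟨C, hC⟩ := hb
  exact ⟨Real.exp C, fun x => by
    rw [abs_of_pos (Real.exp_pos _)]; exact Real.exp_le_exp.2 (le_of_abs_le (hC x))⟩

theorem integral_exp_pos_of_abs_le {f : X → ℝ} (hf : Measurable f)
    (hb : ∃ C, ∀ x, |f x| ≤ C) (μ : Measure X) [IsProbabilityMeasure μ] :
    0 < ∫ x, Real.exp (f x) ∂μ :=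
  integral_exp_pos (integrable_of_measurable_of_abs_le hf.exp (exists_abs_exp_le hb) μ)

theorem abs_log_integral_exp_le {f : X → ℝ} (hf : Measurable f) {C : ℝ} (hC : ∀ x, |f x| ≤ C)
    (μ : Measure X) [IsProbabilityMeasure μ] : |Real.log (∫ x, Real.exp (f x) ∂μ)| ≤ C := by
  have hi := integrable_of_measurable_of_abs_le hf.exp (exists_abs_exp_le ⟨C, hC⟩) μ
  have hpos := integral_exp_pos_of_abs_le hf ⟨C, hC⟩ μ
  rw [abs_le, Real.le_log_iff_exp_le hpos, Real.log_le_iff_le_exp hpos]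
  constructor
  · simpa using integral_mono (μ := μ) (integrable_const _) hi
      fun x => Real.exp_le_exp.2 (abs_le.1 (hC x)).1
  · simpa using integral_mono (μ := μ) hi (integrable_const _)
      fun x => Real.exp_le_exp.2 (abs_le.1 (hC x)).2

theorem integral_le_log_integral_exp (μ : Measure X) [IsProbabilityMeasure μ] {f : X → ℝ}
    (hf : Measurable f) (hb : ∃ C, ∀ x, |f x| ≤ C) :
    ∫ x, f x ∂μ ≤ Real.log (∫ x, Real.exp (f x) ∂μ) := by
  have := ofReal_integral_sub_log_integral_exp_le_klDiv μ μ
    (integrable_of_measurable_of_abs_le hf hb μ)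
    (integrable_of_measurable_of_abs_le hf.exp (exists_abs_exp_le hb) μ)
  rw [InformationTheory.klDiv_self, nonpos_iff_eq_zero, ENNReal.ofReal_eq_zero] at this
  linarith

/-- The weak-duality half, for one sample: replace Q by an arbitrary Q' at cost ε TV, apply the
Donsker–Varadhan bound to Q' and P, and take the infimum over Q'. -/
theorem integral_le_log_integral_exp_add_dualValue (P Q : Measure X) [IsProbabilityMeasure P]
    [IsProbabilityMeasure Q] {ε : ℝ} (hε : 0 ≤ ε) {h : X → ℝ} (hm : Measurable h)
    (hosc : ∀ x x', h x ≤ h x' + ε) :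
    ∫ x, h x ∂Q ≤ Real.log (∫ x, Real.exp (h x) ∂P) + (dualValue ε Q P).toReal := by
  obtain ⟨x₀⟩ := nonempty_of_isProbabilityMeasure P
  have : Nonempty X := ⟨x₀⟩
  have hbdd : BddBelow (Set.range h) :=
    ⟨h x₀ - ε, by rintro _ ⟨x, rfl⟩; linarith [hosc x₀ x]⟩
  have h0 : ∀ x, (⨅ y, h y) ≤ h x := fun x => ciInf_le hbdd x
  have h1 : ∀ x, h x ≤ (⨅ y, h y) + ε := fun x => by
    linarith [le_ciInf (f := h) (c := h x - ε) fun y => by linarith [hosc x y]]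
  have hb : ∃ C, ∀ x, |h x| ≤ C := ⟨_, fun x => abs_le_max_abs_abs (h0 x) (h1 x)⟩
  rw [← sub_le_iff_le_add', ← ENNReal.ofReal_le_iff_le_toReal (dualValue_ne_top P Q ε)]
  refine le_iInf₂ fun Q' hQ' => ?_
  have e1 := ofReal_integral_sub_log_integral_exp_le_klDiv Q' P
    (integrable_of_measurable_of_abs_le hm hb Q')
    (integrable_of_measurable_of_abs_le hm.exp (exists_abs_exp_le hb) P)
  have e2 := integral_sub_integral_le_mul_tvDist Q' Q hm h0 h1
  calc ENNReal.ofReal (∫ x, h x ∂Q - Real.log (∫ x, Real.exp (h x) ∂P))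
      ≤ ENNReal.ofReal (∫ x, h x ∂Q' - Real.log (∫ x, Real.exp (h x) ∂P)
          + ε * (tvDist Q' Q).toReal) := ENNReal.ofReal_le_ofReal (by linarith)
    _ ≤ _ := ENNReal.ofReal_add_le
    _ ≤ _ := by
      gcongr
      rw [ENNReal.ofReal_mul hε, ENNReal.ofReal_toReal (tvDist_ne_top Q' Q)]

theorem measurable_finCons (n : ℕ) :
    Measurable fun p : X × (Fin n → X) => (Fin.cons p.1 p.2 : Fin (n + 1) → X) := by
  refine measurable_pi_lambda _ fun i => ?_
  refine Fin.cases ?_ (fun j => ?_) i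
  · simpa using measurable_fst
  · simp only [Fin.cons_succ]
    fun_prop

theorem integral_iid_succ (P : Measure X) [IsProbabilityMeasure P] {n : ℕ}
    {F : (Fin (n + 1) → X) → ℝ} (hF : Measurable F) (hb : ∃ C, ∀ x, |F x| ≤ C) :
    ∫ x, F x ∂(iid (n + 1) P) = ∫ a, ∫ y, F (Fin.cons a y) ∂(iid n P) ∂P := by
  have hmp := (measurePreserving_piFinSuccAbove (fun _ : Fin (n + 1) => P) 0).symm
  have e := hmp.integral_comp' F
  simp only [MeasurableEquiv.piFinSuccAbove_symm_apply, Fin.insertNthEquiv_zero] at e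
  rw [iid, ← e, integral_prod]
  · rfl
  · refine integrable_of_measurable_of_abs_le (hF.comp (measurable_finCons n))
      (hb.imp fun C h x => h _) _

/-- A function of bounded coordinatewise oscillation satisfies the `n`-sample version of
the variational bound. -/
theorem integral_iid_le_log_integral_exp_add (P Q : Measure X) [IsProbabilityMeasure P]
    [IsProbabilityMeasure Q] {ε : ℝ} (hε : 0 ≤ ε) (n : ℕ) {g : (Fin n → X) → ℝ}
    (hm : Measurable g) (hb : ∃ C, ∀ x, |g x| ≤ C)
    (hosc : ∀ x i a, g (Function.update x i a) ≤ g x + ε) :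
    ∫ x, g x ∂(iid n Q) ≤
      Real.log (∫ x, Real.exp (g x) ∂(iid n P)) + n * (dualValue ε Q P).toReal := by
  induction n with
  | zero =>
    have hP : iid 0 P = iid 0 Q := by
      rw [iid, iid, Measure.pi_of_empty, Measure.pi_of_empty]
    rw [hP]
    simpa using integral_le_log_integral_exp (iid 0 Q) hm hb
  | succ n ih =>
    obtain ⟨C, hC⟩ := hb
    have hgm : Measurable fun p : X × (Fin n → X) => g (Fin.cons p.1 p.2) :=
      hm.comp (measurable_finCons n)
    have hga (a : X) : Measurable fun y : Fin n → X => g (Fin.cons a y) :=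
      hgm.comp measurable_prodMk_left
    -- The log-partition function over the remaining coordinates, not their mean: it keeps
    -- oscillation ε in the first coordinate, and `∫ e^G dP` reassembles the full exponential
    -- moment.
    set G : X → ℝ := fun a => Real.log (∫ y, Real.exp (g (Fin.cons a y)) ∂(iid n P)) with hG
    have hGm : Measurable G :=
      (hgm.exp.stronglyMeasurable.integral_prod_right' (ν := iid n P)).measurable.log
    have hGb : ∀ a, |G a| ≤ C := fun a => abs_log_integral_exp_le (hga a) (fun y => hC _) _
    have hpos (a : X) : 0 < ∫ y, Real.exp (g (Fin.cons a y)) ∂(iid n P) :=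
      integral_exp_pos_of_abs_le (hga a) ⟨C, fun y => hC _⟩ _
    have hi (a : X) : Integrable (fun y => Real.exp (g (Fin.cons a y))) (iid n P) :=
      integrable_of_measurable_of_abs_le (hga a).exp (exists_abs_exp_le ⟨C, fun y => hC _⟩) _
    have hGosc : ∀ a a', G a ≤ G a' + ε := by
      intro a a'
      simp only [hG]
      rw [← Real.log_exp ε, ← Real.log_mul (hpos a').ne' (Real.exp_pos ε).ne',
        ← integral_mul_const]
      apply Real.log_le_log (hpos a)
      refine integral_mono (hi a) ((hi a').mul_const _) fun y => ?_
      simp only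
      rw [← Real.exp_add, Real.exp_le_exp]
      have := hosc (Fin.cons a' y) 0 a
      rwa [Fin.update_cons_zero] at this
    have hstep : ∀ a, ∫ y, g (Fin.cons a y) ∂(iid n Q) ≤
        G a + n * (dualValue ε Q P).toReal := by
      intro a
      refine ih (hga a) ⟨C, fun y => hC _⟩ fun y i b => ?_
      rw [Fin.cons_update]
      exact hosc _ _ _
    rw [integral_iid_succ Q hm ⟨C, hC⟩,
      integral_iid_succ P hm.exp (exists_abs_exp_le ⟨C, hC⟩)]
    have hint : Integrable G Q := integrable_of_measurable_of_abs_le hGm ⟨C, hGb⟩ Q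
    calc ∫ a, ∫ y, g (Fin.cons a y) ∂(iid n Q) ∂Q
        ≤ ∫ a, (G a + n * (dualValue ε Q P).toReal) ∂Q := by
          refine integral_mono ?_ (hint.add (integrable_const _)) hstep
          refine integrable_of_measurable_of_abs_le
            (hgm.stronglyMeasurable.integral_prod_right' (ν := iid n Q)).measurable
            ⟨C, fun a => ?_⟩ Q
          simpa using norm_integral_le_of_norm_le_const (μ := iid n Q)
            (f := fun y => g (Fin.cons a y)) (ae_of_all _ fun y => hC (Fin.cons a y))
      _ = ∫ a, G a ∂Q + n * (dualValue ε Q P).toReal := by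
          rw [integral_add hint (integrable_const _)]; simp
      _ ≤ Real.log (∫ a, Real.exp (G a) ∂P) + (dualValue ε Q P).toReal
            + n * (dualValue ε Q P).toReal := by
          gcongr
          exact integral_le_log_integral_exp_add_dualValue P Q hε hGm hGosc
      _ = _ := by
          have : ∀ a, Real.exp (G a) = ∫ y, Real.exp (g (Fin.cons a y)) ∂(iid n P) :=
            fun a => Real.exp_log (hpos a)
          simp only [this]
          push_cast
          ring

variable {O : Type*} [MeasurableSpace O] {n : ℕ}

theorem integral_outputLaw (M : Kernel (Fin n → X) O) [IsMarkovKernel M] (P : Measure X)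
    [IsProbabilityMeasure P] {f : O → ℝ} (hf : Measurable f) (hb : ∃ C, ∀ y, |f y| ≤ C) :
    ∫ y, f y ∂(outputLaw M P) = ∫ x, ∫ y, f y ∂(M x) ∂(iid n P) := by
  have hi := integrable_of_measurable_of_abs_le hf hb (outputLaw M P)
  rw [outputLaw, Measure.comp_eq_comp_const_apply] at hi ⊢
  rw [Kernel.integral_comp hi, Kernel.const_apply]

theorem IsDP.update_le {ε : ℝ} (hε : 0 ≤ ε) {M : Kernel (Fin n → X) O} (hM : IsDP ε M)
    (x : Fin n → X) (i : Fin n) (a : X) :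
    M (Function.update x i a) ≤ ENNReal.ofReal (Real.exp ε) • M x := by
  refine Measure.le_iff.2 fun S hS => ?_
  rw [Measure.smul_apply, smul_eq_mul]
  -- Neighbours must differ somewhere, so a trivial update is treated apart, using ε ≥ 0.
  by_cases h : a = x i
  · rw [h, Function.update_eq_self]
    exact le_mul_of_one_le_left' (by simpa using hε)
  · refine hM _ _ ⟨i, by simpa using h, fun j hj => ?_⟩ S hS
    by_contra hji
    simp [Function.update_of_ne hji] at hj

/-- Group privacy: any dataset is reached from any other by at most n single-entry changes. -/
theorem IsDP.le_smul {ε : ℝ} (hε : 0 ≤ ε) {M : Kernel (Fin n → X) O} (hM : IsDP ε M)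
    (x x' : Fin n → X) : M x ≤ ENNReal.ofReal (Real.exp (n * ε)) • M x' := by
  classical
  have key : ∀ s : Finset (Fin n),
      M (s.piecewise x x') ≤ ENNReal.ofReal (Real.exp (s.card * ε)) • M x' := by
    intro s
    induction s using Finset.induction_on with
    | empty => simp
    | insert i s hi ih =>
      rw [Finset.piecewise_insert, Finset.card_insert_of_notMem hi]
      refine (hM.update_le hε _ _ _).trans ?_
      refine Measure.le_iff.2 fun S hS => ?_
      simp only [Measure.smul_apply, smul_eq_mul]
      refine (mul_le_mul_right (ih S) _).trans ?_
      rw [Measure.smul_apply, smul_eq_mul, ← mul_assoc, ← ENNReal.ofReal_mul (Real.exp_pos _).le, ← Real.exp_add]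
      apply le_of_eq
      push_cast
      ring_nf
  simpa using key Finset.univ

/-- Serves only to bound the likelihood ratio of the output laws; the constant nε does not reach the
final bound. -/
theorem IsDP.outputLaw_le_smul {ε : ℝ} (hε : 0 ≤ ε) {M : Kernel (Fin n → X) O}
    (hM : IsDP ε M) (P Q : Measure X) [IsProbabilityMeasure P] [IsProbabilityMeasure Q] :
    outputLaw M Q ≤ ENNReal.ofReal (Real.exp (n * ε)) • outputLaw M P := by
  refine Measure.le_iff.2 fun S hS => ?_
  rw [Measure.smul_apply, smul_eq_mul, outputLaw, outputLaw,
    Measure.bind_apply hS M.aemeasurable, Measure.bind_apply hS M.aemeasurable,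
    ← lintegral_const_mul _ (M.measurable_coe hS)]
  have h1 : ∀ x', ∫⁻ x, M x S ∂(iid n Q) ≤ ENNReal.ofReal (Real.exp (n * ε)) * M x' S := by
    intro x'
    calc ∫⁻ x, M x S ∂(iid n Q)
        ≤ ∫⁻ _, ENNReal.ofReal (Real.exp (n * ε)) * M x' S ∂(iid n Q) :=
          lintegral_mono fun x => hM.le_smul hε x x' S
      _ = _ := by simp
  calc ∫⁻ x, M x S ∂(iid n Q) = ∫⁻ _, (∫⁻ x, M x S ∂(iid n Q)) ∂(iid n P) := by simp
    _ ≤ _ := lintegral_mono h1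

theorem IsDP.integral_outputLaw_le {ε : ℝ} (hε : 0 ≤ ε) {M : Kernel (Fin n → X) O}
    [IsMarkovKernel M] (hM : IsDP ε M) (P Q : Measure X) [IsProbabilityMeasure P]
    [IsProbabilityMeasure Q] {f : O → ℝ} (hf : Measurable f) (hb : ∃ C, ∀ y, |f y| ≤ C) :
    ∫ y, f y ∂(outputLaw M Q) ≤
      Real.log (∫ y, Real.exp (f y) ∂(outputLaw M P)) + n * (dualValue ε Q P).toReal := by
  set g : (Fin n → X) → ℝ := fun x => Real.log (∫ y, Real.exp (f y) ∂(M x)) with hg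
  have hpos : ∀ x, 0 < ∫ y, Real.exp (f y) ∂(M x) := fun x =>
    integral_exp_pos_of_abs_le hf hb _
  have hgm : Measurable g := (hf.exp.stronglyMeasurable.integral_kernel (κ := M)).measurable.log
  have hgb : ∃ C, ∀ x, |g x| ≤ C := hb.imp fun C hC x => abs_log_integral_exp_le hf hC _
  have hosc : ∀ x i a, g (Function.update x i a) ≤ g x + ε := by
    intro x i a
    simp only [hg]
    rw [← Real.log_exp ε, ← Real.log_mul (hpos x).ne' (Real.exp_pos ε).ne']
    apply Real.log_le_log (hpos _)
    have hle := hM.update_le hε x i a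
    have := integral_mono_measure (f := fun y => Real.exp (f y)) hle
      (ae_of_all _ fun y => (Real.exp_pos _).le)
      ((integrable_of_measurable_of_abs_le hf.exp (exists_abs_exp_le hb) _).smul_measure
        ENNReal.ofReal_ne_top)
    rw [integral_smul_measure, ENNReal.toReal_ofReal (Real.exp_pos _).le, smul_eq_mul] at this
    rw [mul_comm]
    exact this
  have h1 := integral_iid_le_log_integral_exp_add P Q hε n hgm hgb hosc
  have h2 : ∀ x, Real.exp (g x) = ∫ y, Real.exp (f y) ∂(M x) := fun x => Real.exp_log (hpos x)
  simp only [h2] at h1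
  rw [integral_outputLaw M Q hf hb, integral_outputLaw M P hf.exp (exists_abs_exp_le hb)]
  -- Jensen: the mean of f under M(x) is at most g(x).
  refine le_trans (integral_mono ?_ (integrable_of_measurable_of_abs_le hgm hgb _)
    fun x => integral_le_log_integral_exp (M x) hf hb) h1
  refine integrable_of_measurable_of_abs_le
    (hf.stronglyMeasurable.integral_kernel (κ := M)).measurable (hb.imp fun C hC x => ?_) _
  simpa using norm_integral_le_of_norm_le_const (μ := M x) (f := f) (ae_of_all _ hC)

theorem IsDP.klDiv_outputLaw_le {ε : ℝ} (hε : 0 ≤ ε) {M : Kernel (Fin n → X) O}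
    [IsMarkovKernel M] (hM : IsDP ε M) (P Q : Measure X) [IsProbabilityMeasure P]
    [IsProbabilityMeasure Q] :
    InformationTheory.klDiv (outputLaw M Q) (outputLaw M P) ≤ n * dualValue ε Q P := by
  have := klDiv_le_of_forall_bounded (outputLaw M Q) (outputLaw M P)
    (hM.outputLaw_le_smul hε P Q) (hM.outputLaw_le_smul hε Q P)
    (fun f hf hb => hM.integral_outputLaw_le hε P Q hf hb)
  rwa [ENNReal.ofReal_mul (Nat.cast_nonneg n), ENNReal.ofReal_natCast,
    ENNReal.ofReal_toReal (dualValue_ne_top P Q ε)] at this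

theorem maxKLRate_le_dualValue (P Q : Measure X) [IsProbabilityMeasure P]
    [IsProbabilityMeasure Q] {ε : ℝ} (hε : 0 ≤ ε) (n : ℕ) :
    maxKLRate.{_, v} ε Q P n ≤ dualValue ε Q P := by
  refine iSup_le fun O => iSup_le fun _ => iSup_le fun M => iSup_le fun _ => iSup_le fun hM => ?_
  refine ENNReal.div_le_of_le_mul' ?_
  exact hM.klDiv_outputLaw_le hε P Q

end Converse

/-! ### Upper bound for the e-power -/

section EVariables

theorem toENNReal_log_coe (y : ℝ≥0) :
    (ENNReal.log (y : ℝ≥0∞)).toENNReal = ENNReal.ofReal (Real.log y) := by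
  by_cases hy : y = 0
  · simp [hy]
  · rw [ENNReal.log_of_nnreal hy, EReal.real_coe_toENNReal]

theorem toENNReal_neg_log_coe {y : ℝ≥0} (hy : y ≠ 0) :
    (-ENNReal.log (y : ℝ≥0∞)).toENNReal = ENNReal.ofReal (-Real.log y) := by
  rw [ENNReal.log_of_nnreal hy, ← EReal.coe_neg, EReal.real_coe_toENNReal]

/-- If the exponential moments of the truncated logarithms control their means up to `D`,
then the extended expectation of the logarithm is at most `D`. -/
theorem expLog_le_of_forall_bounded {μ ν : Measure ℝ≥0} [IsProbabilityMeasure μ]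
    [IsProbabilityMeasure ν] {D : ℝ≥0∞} (hD' : D ≠ ∞) (hν : ∫⁻ y, (y : ℝ≥0∞) ∂ν ≤ 1)
    (hD : ∀ f : ℝ≥0 → ℝ, Measurable f → (∃ C, ∀ x, |f x| ≤ C) →
      ∫ x, f x ∂μ ≤ Real.log (∫ x, Real.exp (f x) ∂ν) + D.toReal) :
    expLog μ ≤ D := by
  set N : ℝ≥0∞ := ∫⁻ y, (-ENNReal.log (y : ℝ≥0∞)).toENNReal ∂μ with hN
  unfold expLog
  rw [← hN]
  -- If the negative part has infinite integral, the extended difference is -∞, even when the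
  -- positive part is infinite too.
  by_cases hNtop : N = ∞
  · simp [hNtop]
  apply EReal.sub_le_of_le_add
  rw [← EReal.coe_ennreal_add, EReal.coe_ennreal_le_coe_ennreal_iff]
  -- Truncation to `[e^{-k}, e^k]` makes the logarithm bounded and raises the ν-mean to at most `1 +
  -- e^{-k}`, whose logarithm is at most `e^{-k}`.
  let t : ℕ → ℝ≥0 → ℝ := fun k y => max (Real.exp (-k)) (min y (Real.exp k))
  have ht0 : ∀ k y, 0 < t k y := fun k y => lt_max_of_lt_left (Real.exp_pos _)
  have htm : ∀ k, Measurable (t k) := fun k => by fun_prop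
  have hint : Integrable (fun y : ℝ≥0 => (y : ℝ)) ν := by
    refine ⟨by fun_prop, ?_⟩
    rw [hasFiniteIntegral_iff_enorm]
    refine lt_of_le_of_lt (le_of_eq ?_) (hν.trans_lt ENNReal.one_lt_top)
    congr with y
    simp [enorm_eq_nnnorm]
  have hint1 : ∫ y, (y : ℝ) ∂ν ≤ 1 := by
    rw [integral_eq_lintegral_of_nonneg_ae (ae_of_all _ fun y => y.2) (by fun_prop)]
    refine ENNReal.toReal_le_of_le_ofReal zero_le_one ?_
    simpa using hν
  have hlb : ∀ k y, |Real.log (t k y)| ≤ (k : ℝ) := by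
    intro k y
    rw [abs_le, Real.le_log_iff_exp_le (ht0 k y), Real.log_le_iff_le_exp (ht0 k y)]
    exact ⟨le_max_left _ _, max_le (Real.exp_le_exp.2 (by
      have := Nat.cast_nonneg (α := ℝ) k; linarith)) (min_le_right _ _)⟩
  have hstep : ∀ k : ℕ, ∫⁻ y, ENNReal.ofReal (Real.log (t k y)) ∂μ ≤
      ENNReal.ofReal (Real.exp (-k)) + (D + N) := by
    intro k
    have hI : Integrable (fun y => Real.log (t k y)) μ :=
      integrable_of_measurable_of_abs_le (htm k).log ⟨k, hlb k⟩ μ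
    have h1 := hD (fun y => Real.log (t k y)) (htm k).log ⟨k, hlb k⟩
    have h2 : Real.log (∫ y, Real.exp (Real.log (t k y)) ∂ν) ≤ Real.exp (-k) := by
      simp only [Real.exp_log (ht0 _ _)]
      have htb : ∀ y, |t k y| ≤ Real.exp k := fun y => by
        rw [abs_of_pos (ht0 _ _)]
        exact max_le (Real.exp_le_exp.2 (by
          have := Nat.cast_nonneg (α := ℝ) k; linarith)) (min_le_right _ _)
      have h3 : ∫ y, t k y ∂ν ≤ Real.exp (-k) + 1 := by
        calc ∫ y, t k y ∂ν ≤ ∫ y, (Real.exp (-k) + (y : ℝ)) ∂ν := by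
              refine integral_mono (integrable_of_measurable_of_abs_le (htm k) ⟨_, htb⟩ ν)
                ((integrable_const _).add hint) fun y => ?_
              have h5 := (Real.exp_pos (-k : ℝ)).le
              have h6 : (0 : ℝ) ≤ y := y.2
              exact max_le (by linarith) ((min_le_left _ _).trans (by linarith))
          _ ≤ _ := by
              rw [integral_add (integrable_const _) hint]
              simpa using hint1
      have h4 := Real.log_le_sub_one_of_pos (x := ∫ y, t k y ∂ν) (by
        have := integral_exp_pos_of_abs_le (htm k).log ⟨k, hlb k⟩ ν
        simpa only [Real.exp_log (ht0 _ _)] using this)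
      linarith
    rw [integral_eq_lintegral_pos_part_sub_lintegral_neg_part hI] at h1
    have hneg : ∫⁻ y, ENNReal.ofReal (-Real.log (t k y)) ∂μ ≤ N := by
      refine lintegral_mono fun y => ?_
      by_cases hy : y = 0
      · simp [hy]
      · rw [toENNReal_neg_log_coe hy]
        have hy' : (0 : ℝ) < y := by positivity
        rw [ENNReal.ofReal_le_ofReal_iff']
        by_cases hy1 : (y : ℝ) ≤ 1
        · left
          rw [neg_le_neg_iff]
          refine Real.log_le_log hy' (le_max_of_le_right (le_min le_rfl ?_))
          exact hy1.trans (Real.one_le_exp (Nat.cast_nonneg k))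
        · right
          rw [neg_nonpos]
          refine Real.log_nonneg (le_max_of_le_right (le_min (not_le.1 hy1).le ?_))
          exact Real.one_le_exp (Nat.cast_nonneg k)
    have hpos : ∫⁻ y, ENNReal.ofReal (Real.log (t k y)) ∂μ ≠ ∞ := by
      refine ne_of_lt (lt_of_le_of_lt (lintegral_mono fun y => ENNReal.ofReal_le_ofReal
        (le_of_abs_le (hlb k y))) ?_)
      simp
    rw [← ENNReal.ofReal_toReal hpos]
    have hnegR := ENNReal.toReal_mono hNtop hneg
    rw [← ENNReal.ofReal_toReal hD', ← ENNReal.ofReal_toReal hNtop,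
      ← ENNReal.ofReal_add ENNReal.toReal_nonneg ENNReal.toReal_nonneg,
      ← ENNReal.ofReal_add (Real.exp_pos _).le (by positivity)]
    apply ENNReal.ofReal_le_ofReal
    linarith
  have hpt : ∀ y : ℝ≥0, liminf (fun k : ℕ => ENNReal.ofReal (Real.log (t k y))) atTop =
      (ENNReal.log (y : ℝ≥0∞)).toENNReal := by
    intro y
    rw [toENNReal_log_coe]
    refine Tendsto.liminf_eq ?_
    by_cases hy : (y : ℝ) ≤ 1
    · refine tendsto_const_nhds.congr fun k => ?_
      rw [ENNReal.ofReal_of_nonpos (p := Real.log y) (Real.log_nonpos y.2 hy),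
        ENNReal.ofReal_of_nonpos]
      refine Real.log_nonpos (ht0 k y).le (max_le ?_ ((min_le_left _ _).trans hy))
      exact Real.exp_le_one_iff.2 (by simp)
    · have h1 := not_le.1 hy
      refine tendsto_const_nhds.congr' ?_
      filter_upwards [eventually_ge_atTop ⌈Real.log y⌉₊] with k hk
      have h2 : (y : ℝ) ≤ Real.exp k := by
        rw [← Real.log_le_iff_le_exp (by linarith)]
        exact Nat.ceil_le.1 hk
      have h3 : Real.exp (-k : ℝ) ≤ y := (Real.exp_le_one_iff.2 (by simp)).trans h1.le
      simp only [t]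
      rw [min_eq_left h2, max_eq_right h3]
  simp only [← hpt]
  -- Fatou removes the truncation from the positive part; the negative part was already bounded by N
  -- uniformly in k.
  refine (lintegral_liminf_le fun k => (htm k).log.ennreal_ofReal).trans ?_
  refine (liminf_le_liminf (Eventually.of_forall hstep)).trans (le_of_eq ?_)
  refine Tendsto.liminf_eq ?_
  have : Tendsto (fun k : ℕ => ENNReal.ofReal (Real.exp (-k))) atTop (𝓝 0) := by
    rw [← ENNReal.ofReal_zero]
    refine ENNReal.tendsto_ofReal ?_
    exact Real.tendsto_exp_neg_atTop_nhds_zero.comp tendsto_natCast_atTop_atTop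
  simpa using this.add_const (D + N)

variable {X : Type*} [MeasurableSpace X]

theorem maxEPowerRate_le_dualValue (P Q : Measure X) [IsProbabilityMeasure P]
    [IsProbabilityMeasure Q] {ε : ℝ} (hε : 0 ≤ ε) {n : ℕ} (hn : n ≠ 0) :
    maxEPowerRate ε Q P n ≤ (dualValue ε Q P : ℝ≥0∞) := by
  refine iSup₂_le fun M ⟨hM, hdp, hE⟩ => ?_
  have hn' : (0 : EReal) < (n : EReal) := by exact_mod_cast Nat.pos_of_ne_zero hn
  rw [EReal.div_le_iff_le_mul hn' (EReal.natCast_ne_top n)]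
  have h := expLog_le_of_forall_bounded (D := n * dualValue ε Q P)
    (ENNReal.mul_ne_top (by simp) (dualValue_ne_top P Q ε)) hE
    (fun f hf hb => by
      have := hdp.integral_outputLaw_le hε P Q hf hb
      simpa [ENNReal.toReal_mul] using this)
  rwa [EReal.coe_ennreal_mul, ← ENNReal.ofReal_natCast, EReal.coe_ennreal_ofReal,
    max_eq_left (Nat.cast_nonneg n), EReal.coe_natCast] at h

end EVariables

/-! ### Strong duality via the clipped density -/

section LeastFavorable

variable {X : Type*} [MeasurableSpace X]

theorem clip_mem {c K r : ℝ} (hcK : c ≤ K) : c ≤ max c (min r K) ∧ max c (min r K) ≤ K :=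
  ⟨le_max_left _ _, max_le hcK (min_le_right _ _)⟩

/-- The level `c` at which clipping a density `r` to `[c, c e^ε]` keeps total mass one. -/
theorem exists_integral_clip_eq_one (P : Measure X) [IsProbabilityMeasure P] {ε : ℝ}
    (hε : 0 ≤ ε) {r : X → ℝ} (hr : Measurable r) :
    ∃ c : ℝ, 0 < c ∧ ∫ x, max c (min (r x) (c * Real.exp ε)) ∂P = 1 := by
  have he1 : Real.exp (-ε) ≤ 1 := Real.exp_le_one_iff.2 (by linarith)
  have he2 : 1 ≤ Real.exp ε := Real.one_le_exp hε
  have hbd : ∀ c ∈ Set.Icc (Real.exp (-ε)) 1, ∀ x,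
      ‖max c (min (r x) (c * Real.exp ε))‖ ≤ Real.exp ε := by
    intro c hc x
    have hc0 : 0 < c := (Real.exp_pos _).trans_le hc.1
    have := clip_mem (r := r x) (le_mul_of_one_le_right hc0.le he2)
    rw [Real.norm_of_nonneg (hc0.le.trans this.1)]
    exact this.2.trans (mul_le_of_le_one_left (Real.exp_pos _).le hc.2)
  have hm : ∀ c : ℝ, Measurable fun x => max c (min (r x) (c * Real.exp ε)) :=
    fun c => by fun_prop
  have hi : ∀ c ∈ Set.Icc (Real.exp (-ε)) 1,
      Integrable (fun x => max c (min (r x) (c * Real.exp ε))) P := fun c hc =>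
    Integrable.of_bound (hm c).aestronglyMeasurable _ (ae_of_all _ (hbd c hc))
  have hcont : ContinuousOn (fun c : ℝ => ∫ x, max c (min (r x) (c * Real.exp ε)) ∂P)
      (Set.Icc (Real.exp (-ε)) 1) := by
    refine continuousOn_of_dominated (bound := fun _ => Real.exp ε)
      (fun c _ => (hm c).aestronglyMeasurable) (fun c hc => ae_of_all _ (hbd c hc))
      (integrable_const _) (ae_of_all _ fun x => ?_)
    fun_prop
  -- At `c = e^{-ε}` the clipping window lies below 1, at `c = 1` above it; the intermediate value
  -- theorem applies.
  have hlow : ∫ x, max (Real.exp (-ε)) (min (r x) (Real.exp (-ε) * Real.exp ε)) ∂P ≤ 1 := by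
    refine le_trans (integral_mono (hi _ ⟨le_rfl, he1⟩) (integrable_const 1) fun x => ?_)
      (by simp)
    simpa [← Real.exp_add] using he1
  have hhigh : 1 ≤ ∫ x, max (1 : ℝ) (min (r x) (1 * Real.exp ε)) ∂P := by
    simpa using integral_mono (μ := P) (integrable_const (1 : ℝ)) (hi 1 ⟨he1, le_rfl⟩)
      fun x => le_max_left _ _
  obtain ⟨c, hc, hc1⟩ := intermediate_value_Icc he1 hcont ⟨hlow, hhigh⟩
  exact ⟨c, (Real.exp_pos _).trans_le hc.1, hc1⟩

/-- Strong duality: the infimum is dominated by the variational value of the logarithm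
of the least favorable density ratio. -/
theorem exists_dualValue_le (P Q : Measure X) [IsProbabilityMeasure P]
    [IsProbabilityMeasure Q] {ε : ℝ} (hε : 0 ≤ ε) :
    ∃ h : X → ℝ, Measurable h ∧ (∀ x, 0 ≤ h x) ∧ (∀ x, h x ≤ ε) ∧
      0 ≤ ∫ x, h x ∂Q - Real.log (∫ x, Real.exp (h x) ∂P) ∧
      dualValue ε Q P ≤
        ENNReal.ofReal (∫ x, h x ∂Q - Real.log (∫ x, Real.exp (h x) ∂P)) := by
  classical
  set σ := Q.singularPart P with hσ
  have hsing : σ ⟂ₘ P := Measure.mutuallySingular_singularPart Q P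
  set s := hsing.nullSet with hs_def
  have hs : MeasurableSet s := hsing.measurableSet_nullSet
  have hσs : ∀ᵐ x ∂σ, x ∉ s := measure_eq_zero_iff_ae_notMem.1 hsing.measure_nullSet
  have hPs : ∀ᵐ x ∂P, x ∈ s := by
    have := measure_eq_zero_iff_ae_notMem.1 hsing.measure_compl_nullSet
    filter_upwards [this] with x hx
    simpa using hx
  set r : X → ℝ := fun x => (Q.rnDeriv P x).toReal with hr_def
  have hr : Measurable r := (Measure.measurable_rnDeriv Q P).ennreal_toReal
  have hri : Integrable r P := Measure.integrable_toReal_rnDeriv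
  have hQint : ∀ f : X → ℝ, Measurable f → (∃ C, ∀ x, |f x| ≤ C) →
      ∫ x, f x ∂Q = ∫ x, f x ∂σ + ∫ x, r x * f x ∂P := by
    intro f hf hb
    conv_lhs => rw [← Measure.singularPart_add_rnDeriv Q P]
    rw [integral_add_measure (integrable_of_measurable_of_abs_le hf hb _)
      (integrable_of_measurable_of_abs_le hf hb _),
      integral_withDensity_eq_integral_toReal_smul (Measure.measurable_rnDeriv Q P)
        (Measure.rnDeriv_lt_top Q P)]
    rfl
  obtain ⟨c, hc, hc1⟩ := exists_integral_clip_eq_one P hε hr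
  have hcK : c ≤ c * Real.exp ε := le_mul_of_one_le_right hc.le (Real.one_le_exp hε)
  -- The singular part of Q lives off s, where the density ratio is morally infinite; there w takes
  -- the upper clipping value, so that h = ε.
  set w : X → ℝ := s.piecewise (fun x => max c (min (r x) (c * Real.exp ε)))
    (fun _ => c * Real.exp ε) with hw_def
  have hw : Measurable w := Measurable.piecewise hs (by fun_prop) measurable_const
  have hwb : ∀ x, c ≤ w x ∧ w x ≤ c * Real.exp ε := by
    intro x
    by_cases hx : x ∈ s
    · simpa [hw_def, hx] using clip_mem (r := r x) hcK
    · simpa [hw_def, hx] using hcK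
  have hw0 : ∀ x, 0 < w x := fun x => hc.trans_le (hwb x).1
  have hwbd : ∃ C, ∀ x, |w x| ≤ C :=
    ⟨_, fun x => by rw [abs_of_pos (hw0 x)]; exact (hwb x).2⟩
  have hw1 : ∫ x, w x ∂P = 1 := by
    rw [← hc1]
    apply integral_congr_ae
    filter_upwards [hPs] with x hx
    simp [hw_def, hx]
  set h : X → ℝ := fun x => Real.log (w x) - Real.log c with hh_def
  have hhm : Measurable h := hw.log.sub_const _
  have hh0 : ∀ x, 0 ≤ h x := fun x => sub_nonneg.2 (Real.log_le_log hc (hwb x).1)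
  have hh1 : ∀ x, h x ≤ ε := fun x => by
    have := Real.log_le_log (hw0 x) (hwb x).2
    rw [Real.log_mul hc.ne' (Real.exp_pos ε).ne', Real.log_exp] at this
    simp only [hh_def]; linarith
  have hhb : ∃ C, ∀ x, |h x| ≤ C :=
    ⟨ε, fun x => by rw [abs_of_nonneg (hh0 x)]; exact hh1 x⟩
  have htop : ∀ x, w x = c * Real.exp ε → h x = ε := fun x hx => by
    simp only [hh_def]
    rw [hx, Real.log_mul hc.ne' (Real.exp_pos ε).ne', Real.log_exp]; ring
  have hbot : ∀ x, w x = c → h x = 0 := fun x hx => by simp [hh_def, hx]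
  refine ⟨h, hhm, hh0, hh1, ?_⟩
  have hexp : ∫ x, Real.exp (h x) ∂P = c⁻¹ := by
    have : ∀ x, Real.exp (h x) = w x * c⁻¹ := fun x => by
      simp only [hh_def]
      rw [Real.exp_sub, Real.exp_log (hw0 x), Real.exp_log hc]; rfl
    simp only [this]
    rw [integral_mul_const, hw1, one_mul]
  rw [hexp, Real.log_inv, sub_neg_eq_add]
  set Q' : Measure X := P.withDensity fun x => ENNReal.ofReal (w x) with hQ'
  have hQ'int : ∀ f : X → ℝ, ∫ x, f x ∂Q' = ∫ x, w x * f x ∂P := by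
    intro f
    rw [hQ', integral_withDensity_eq_integral_toReal_smul hw.ennreal_ofReal
      (ae_of_all _ fun x => ENNReal.ofReal_lt_top)]
    refine integral_congr_ae (ae_of_all _ fun x => ?_)
    simp [ENNReal.toReal_ofReal (hw0 x).le]
  have hprob : IsProbabilityMeasure Q' := by
    constructor
    rw [hQ', withDensity_apply _ MeasurableSet.univ, Measure.restrict_univ,
      ← ofReal_integral_eq_lintegral_ofReal (integrable_of_measurable_of_abs_le hw hwbd P)
        (ae_of_all _ fun x => (hw0 x).le), hw1, ENNReal.ofReal_one]
  have hac : Q' ≪ P := withDensity_absolutelyContinuous _ _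
  have hllr : llr Q' P =ᵐ[Q'] fun x => h x + Real.log c := by
    apply hac.ae_le
    filter_upwards [Measure.rnDeriv_withDensity P hw.ennreal_ofReal] with x hx
    rw [llr, hx, ENNReal.toReal_ofReal (hw0 x).le]
    simp [hh_def]
  have hhi : Integrable h Q' := integrable_of_measurable_of_abs_le hhm hhb Q'
  have hlint : Integrable (llr Q' P) Q' :=
    (hhi.add (integrable_const (Real.log c))).congr hllr.symm
  have hIllr : ∫ x, llr Q' P x ∂Q' = ∫ x, h x ∂Q' + Real.log c := by
    rw [integral_congr_ae hllr, integral_add hhi (integrable_const _)]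
    simp
  have hKL : InformationTheory.klDiv Q' P = ENNReal.ofReal (∫ x, h x ∂Q' + Real.log c) := by
    rw [InformationTheory.klDiv_of_ac_of_integrable hac hlint, hIllr]
    simp
  have hKL0 : 0 ≤ ∫ x, h x ∂Q' + Real.log c := by
    have := InformationTheory.integral_llr_add_sub_measure_univ_nonneg hac hlint
    rw [hIllr] at this
    simpa using this
  -- Complementary slackness: h = 0 where w exceeds the density of Q and h = ε where it falls short,
  -- so `h - ε 1_B` has the sign of Q - Q' or vanishes, for every B.
  have hTV : ∀ B, MeasurableSet B →
      ε * (Q.real B - Q'.real B) ≤ ∫ x, h x ∂Q - ∫ x, h x ∂Q' := by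
    intro B hB
    set k : X → ℝ := fun x => h x - B.indicator (fun _ => ε) x with hk
    have hind : Measurable (B.indicator fun _ => ε) := measurable_const.indicator hB
    have hkm : Measurable k := hhm.sub hind
    have hindb : ∀ x, 0 ≤ B.indicator (fun _ => ε) x ∧ B.indicator (fun _ => ε) x ≤ ε := by
      intro x
      by_cases hx : x ∈ B <;> simp [hx, hε]
    have hkb : ∃ C, ∀ x, |k x| ≤ C := ⟨ε, fun x => by
      rw [abs_le]; simp only [hk]
      constructor <;> linarith [hh0 x, hh1 x, (hindb x).1, (hindb x).2]⟩
    have hkint (ρ : Measure X) [IsFiniteMeasure ρ] :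
        ∫ x, k x ∂ρ = ∫ x, h x ∂ρ - ε * ρ.real B := by
      rw [integral_sub (integrable_of_measurable_of_abs_le hhm hhb ρ)
        ((integrable_const ε).indicator hB), integral_indicator_const _ hB, smul_eq_mul,
        mul_comm]
    have hσk : 0 ≤ ∫ x, k x ∂σ := by
      apply integral_nonneg_of_ae
      filter_upwards [hσs] with x hx
      have : h x = ε := htop x (by simp [hw_def, hx])
      simp only [hk, this, Pi.zero_apply]
      linarith [(hindb x).2]
    have hPk : ∫ x, w x * k x ∂P ≤ ∫ x, r x * k x ∂P := by
      obtain ⟨C, hC⟩ := hkb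
      have hki : Integrable (fun x => w x * k x) P :=
        (integrable_of_measurable_of_abs_le hw hwbd P).mul_bdd (c := C) hkm.aestronglyMeasurable
          (ae_of_all _ hC)
      have hkr : Integrable (fun x => r x * k x) P :=
        hri.mul_bdd (c := C) hkm.aestronglyMeasurable (ae_of_all _ hC)
      refine integral_mono_ae hki hkr ?_
      filter_upwards [hPs] with x hx
      have hwx : w x = max c (min (r x) (c * Real.exp ε)) := by simp [hw_def, hx]
      rcases lt_trichotomy (r x) (w x) with hlt | heq | hgt
      · have : w x = c := by
          rcases max_choice c (min (r x) (c * Real.exp ε)) with h' | h'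
          · rw [hwx, h']
          · exfalso
            rw [hwx, h'] at hlt
            exact absurd (min_le_left _ _) (not_le.2 hlt)
        have h2 := hbot x this
        refine mul_le_mul_of_nonpos_right hlt.le ?_
        simp only [hk, h2]
        linarith [(hindb x).1]
      · rw [heq]
      · have : w x = c * Real.exp ε := by
          refine le_antisymm (hwb x).2 ?_
          by_contra hcon
          have h3 : min (r x) (c * Real.exp ε) ≤ w x := hwx ▸ le_max_right _ _
          rcases min_choice (r x) (c * Real.exp ε) with h' | h' <;> rw [h'] at h3
          · linarith
          · exact hcon h3
        have h2 := htop x this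
        refine mul_le_mul_of_nonneg_right hgt.le ?_
        simp only [hk, h2]
        linarith [(hindb x).2]
    have e1 := hQint k hkm hkb
    have e2 := hQ'int k
    rw [hkint Q] at e1
    rw [hkint Q'] at e2
    linarith
  have hTV0 : 0 ≤ ∫ x, h x ∂Q - ∫ x, h x ∂Q' := by
    simpa using hTV ∅ MeasurableSet.empty
  have hTVle : ENNReal.ofReal ε * tvDist Q' Q ≤
      ENNReal.ofReal (∫ x, h x ∂Q - ∫ x, h x ∂Q') := by
    simp only [tvDist, ENNReal.mul_iSup]
    refine iSup₂_le fun A hA => ?_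
    rw [← ENNReal.ofReal_mul hε]
    apply ENNReal.ofReal_le_ofReal
    rcases abs_cases (Q'.real A - Q.real A) with ⟨h', -⟩ | ⟨h', -⟩ <;> rw [h']
    · have := hTV Aᶜ hA.compl
      rw [probReal_compl_eq_one_sub hA, probReal_compl_eq_one_sub hA] at this
      linarith
    · have := hTV A hA
      linarith
  refine ⟨by linarith, ?_⟩
  calc dualValue ε Q P
      ≤ InformationTheory.klDiv Q' P + ENNReal.ofReal ε * tvDist Q' Q := iInf₂_le Q' hprob
    _ ≤ ENNReal.ofReal (∫ x, h x ∂Q' + Real.log c) +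
          ENNReal.ofReal (∫ x, h x ∂Q - ∫ x, h x ∂Q') := by
        rw [hKL]; gcongr
    _ = ENNReal.ofReal (∫ x, h x ∂Q + Real.log c) := by
        rw [← ENNReal.ofReal_add hKL0 hTV0]
        congr 1
        ring

end LeastFavorable

/-! ### The standard Laplace distribution -/

section Laplace

/-- The standard Laplace distribution, with density `e^{-|z|} / 2`. -/
noncomputable def laplace : Measure ℝ :=
  volume.withDensity fun z => ENNReal.ofReal (Real.exp (-|z|) / 2)

theorem integral_exp_neg_abs : ∫ z : ℝ, Real.exp (-|z|) = 2 := by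
  rw [integral_comp_abs (f := fun z => Real.exp (-z)), integral_exp_neg_Ioi_zero, mul_one]

theorem integrable_exp_neg_abs : Integrable fun z : ℝ => Real.exp (-|z|) := by
  -- A non-integrable function would have integral 0 by convention, whereas this one has integral 2.
  by_contra h
  have := integral_undef h
  rw [integral_exp_neg_abs] at this
  norm_num at this

theorem integrable_abs_mul_exp_neg_abs : Integrable fun z : ℝ => |z| * Real.exp (-|z|) := by
  by_contra h
  have h1 := integral_undef h
  rw [integral_comp_abs (f := fun z => z * Real.exp (-z))] at h1
  have h2 := Real.Gamma_eq_integral (s := 2) (by norm_num)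
  have h3 : ∫ x in Set.Ioi (0 : ℝ), Real.exp (-x) * x ^ ((2 : ℝ) - 1) =
      ∫ x in Set.Ioi (0 : ℝ), x * Real.exp (-x) := by
    congr with x
    norm_num
    ring
  rw [h3, Real.Gamma_two] at h2
  linarith

theorem measurable_laplace_density :
    Measurable fun z : ℝ => ENNReal.ofReal (Real.exp (-|z|) / 2) := by fun_prop

theorem integral_laplace (f : ℝ → ℝ) :
    ∫ z, f z ∂laplace = ∫ z, Real.exp (-|z|) / 2 * f z := by
  rw [laplace, integral_withDensity_eq_integral_toReal_smul measurable_laplace_density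
    (ae_of_all _ fun x => ENNReal.ofReal_lt_top)]
  refine integral_congr_ae (ae_of_all _ fun z => ?_)
  simp [ENNReal.toReal_ofReal (div_pos (Real.exp_pos (-|z|)) two_pos).le]

theorem integrable_laplace_iff {f : ℝ → ℝ} :
    Integrable f laplace ↔ Integrable fun z => Real.exp (-|z|) / 2 * f z := by
  rw [laplace, integrable_withDensity_iff_integrable_smul' measurable_laplace_density
    (ae_of_all _ fun x => ENNReal.ofReal_lt_top)]
  refine integrable_congr (ae_of_all _ fun z => ?_)
  simp [ENNReal.toReal_ofReal (div_pos (Real.exp_pos (-|z|)) two_pos).le]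

instance isProbabilityMeasure_laplace : IsProbabilityMeasure laplace := by
  constructor
  rw [laplace, withDensity_apply _ MeasurableSet.univ, Measure.restrict_univ,
    ← ofReal_integral_eq_lintegral_ofReal (integrable_exp_neg_abs.div_const 2)
      (ae_of_all _ fun z => (div_pos (Real.exp_pos _) two_pos).le), integral_div,
    integral_exp_neg_abs]
  norm_num

theorem integrable_abs_laplace : Integrable (fun z => |z|) laplace := by
  rw [integrable_laplace_iff]
  refine (integrable_abs_mul_exp_neg_abs.div_const 2).congr (ae_of_all _ fun z => ?_)
  simp only
  ring

theorem laplace_map_add_apply (s : ℝ) {A : Set ℝ} (hA : MeasurableSet A) :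
    laplace.map (fun z => s + z) A =
      ∫⁻ z in A, ENNReal.ofReal (Real.exp (-|z - s|) / 2) := by
  have hA' : MeasurableSet ((fun z => s + z) ⁻¹' A) := (measurable_const_add s) hA
  rw [Measure.map_apply (measurable_const_add s) hA, laplace, withDensity_apply _ hA',
    ← lintegral_indicator hA', ← lintegral_indicator hA,
    ← lintegral_add_left_eq_self
      (A.indicator fun z => ENNReal.ofReal (Real.exp (-|z - s|) / 2)) s]
  congr with z
  by_cases hz : s + z ∈ A <;> simp [Set.indicator, hz]

theorem laplace_map_add_le (s s' : ℝ) :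
    laplace.map (fun z => s + z) ≤
      ENNReal.ofReal (Real.exp |s - s'|) • laplace.map (fun z => s' + z) := by
  refine Measure.le_iff.2 fun A hA => ?_
  rw [Measure.smul_apply, smul_eq_mul, laplace_map_add_apply s hA, laplace_map_add_apply s' hA,
    ← lintegral_const_mul _ (by fun_prop)]
  refine lintegral_mono fun z => ?_
  rw [← ENNReal.ofReal_mul (Real.exp_pos _).le, ← mul_div_assoc, ← Real.exp_add]
  refine ENNReal.ofReal_le_ofReal (div_le_div_of_nonneg_right (Real.exp_le_exp.2 ?_) two_pos.le)
  have := abs_sub_abs_le_abs_sub (z - s') (z - s)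
  rw [show z - s' - (z - s) = s - s' by ring] at this
  linarith

/-- The exponential moment of truncated Laplace noise grows linearly in the truncation level. -/
theorem integral_exp_min_laplace_le {L : ℝ} (hL : 0 ≤ L) :
    ∫ z, Real.exp (min (max z 0) L) ∂laplace ≤ 2 + L := by
  have hi2 : Integrable fun z : ℝ => Real.exp (-|z - L|) := integrable_exp_neg_abs.comp_sub_right L
  have hind : Integrable ((Set.Icc 0 L).indicator fun _ : ℝ => (1 : ℝ)) :=
    (integrableOn_const (by simp)).integrable_indicator measurableSet_Icc
  -- On [0, L] the exponential cancels the decay of the density, leaving the constant 1/2; the two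
  -- tails are exponential, around 0 and L.
  have hbound : ∀ z : ℝ, Real.exp (-|z|) / 2 * Real.exp (min (max z 0) L) ≤
      ((Set.Icc 0 L).indicator (fun _ : ℝ => (1 : ℝ)) z + Real.exp (-|z|) +
        Real.exp (-|z - L|)) / 2 := by
    intro z
    have h1 := Real.exp_pos (-|z|)
    have h2 := Real.exp_pos (-|z - L|)
    rw [div_mul_eq_mul_div, ← Real.exp_add]
    refine div_le_div_of_nonneg_right ?_ two_pos.le
    by_cases hz : z ∈ Set.Icc 0 L
    · rw [Set.indicator_of_mem hz, max_eq_left hz.1, min_eq_left hz.2, abs_of_nonneg hz.1]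
      simp only [neg_add_cancel, Real.exp_zero]
      linarith [Real.exp_pos (-z)]
    · rw [Set.indicator_of_notMem hz]
      by_cases hz0 : z ≤ 0
      · rw [max_eq_right hz0, min_eq_left hL, add_zero]
        linarith
      · have hzL : L ≤ z := by
          by_contra hcon
          exact hz ⟨(not_le.1 hz0).le, (not_le.1 hcon).le⟩
        rw [max_eq_left (not_le.1 hz0).le, min_eq_right hzL,
          abs_of_nonneg (not_le.1 hz0).le, abs_of_nonneg (sub_nonneg.2 hzL),
          show -z + L = -(z - L) by ring]
        linarith [Real.exp_pos (-z)]
  rw [integral_laplace]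
  have hI := ((hind.add integrable_exp_neg_abs).add hi2).div_const 2
  refine (integral_mono_of_nonneg (ae_of_all _ fun z => by positivity) hI
    (ae_of_all _ hbound)).trans ?_
  have h3 : ∫ z : ℝ, Real.exp (-|z - L|) = 2 := by
    rw [integral_sub_right_eq_self (fun z : ℝ => Real.exp (-|z|)) L, integral_exp_neg_abs]
  rw [integral_div, integral_add' (hind.add integrable_exp_neg_abs) hi2,
    integral_add' hind integrable_exp_neg_abs, h3, integral_exp_neg_abs,
    integral_indicator_const _ measurableSet_Icc, Real.volume_real_Icc_of_le hL]
  simp only [smul_eq_mul]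
  linarith

end Laplace

/-! ### Achievability: the noisy, clipped log-likelihood sum -/

section Mechanism

variable {X : Type*} [MeasurableSpace X] {n : ℕ}

/-- The mechanism that releases a real statistic with additive standard Laplace noise. -/
noncomputable def laplaceMechanism {Y : Type*} [MeasurableSpace Y] (S : Y → ℝ) : Kernel Y ℝ :=
  (Kernel.id ×ₖ Kernel.const Y laplace).map fun p => S p.1 + p.2

theorem laplaceMechanism_apply {Y : Type*} [MeasurableSpace Y] {S : Y → ℝ} (hS : Measurable S)
    (x : Y) : laplaceMechanism S x = laplace.map fun z => S x + z := by
  rw [laplaceMechanism, Kernel.map_apply _ (by fun_prop), Kernel.prod_apply, Kernel.id_apply,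
    Kernel.const_apply, Measure.dirac_prod, Measure.map_map (by fun_prop) (by fun_prop)]
  rfl

theorem isMarkovKernel_laplaceMechanism {Y : Type*} [MeasurableSpace Y] {S : Y → ℝ}
    (hS : Measurable S) : IsMarkovKernel (laplaceMechanism S) :=
  Kernel.IsMarkovKernel.map _ (by fun_prop)

theorem isDP_laplaceMechanism {S : (Fin n → X) → ℝ} (hS : Measurable S) {ε : ℝ}
    (hlip : ∀ x x', Neighbors x x' → |S x - S x'| ≤ ε) : IsDP ε (laplaceMechanism S) := by
  intro x x' hxx' A _
  rw [laplaceMechanism_apply hS, laplaceMechanism_apply hS]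
  refine (laplace_map_add_le (S x) (S x') A).trans ?_
  rw [Measure.smul_apply, smul_eq_mul]
  gcongr
  exact hlip x x' hxx'

theorem integral_laplaceMechanism {Y : Type*} [MeasurableSpace Y] {S : Y → ℝ}
    (hS : Measurable S) (x : Y) {f : ℝ → ℝ} (hf : Measurable f) :
    ∫ y, f y ∂(laplaceMechanism S x) = ∫ z, f (S x + z) ∂laplace := by
  rw [laplaceMechanism_apply hS, integral_map (by fun_prop) hf.aestronglyMeasurable]

theorem IsDP.map {O O' : Type*} [MeasurableSpace O] [MeasurableSpace O'] {ε : ℝ}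
    {M : Kernel (Fin n → X) O} (hM : IsDP ε M) {g : O → O'} (hg : Measurable g) :
    IsDP ε (M.map g) := by
  intro x x' hxx' A hA
  rw [Kernel.map_apply' _ hg _ hA, Kernel.map_apply' _ hg _ hA]
  exact hM x x' hxx' _ (hg hA)

theorem outputLaw_map {O O' : Type*} [MeasurableSpace O] [MeasurableSpace O']
    (M : Kernel (Fin n → X) O) (P : Measure X) {g : O → O'} (hg : Measurable g) :
    outputLaw (M.map g) P = (outputLaw M P).map g := by
  ext A hA
  rw [Measure.map_apply hg hA, outputLaw, outputLaw, Measure.bind_apply hA (Kernel.aemeasurable _),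
    Measure.bind_apply (hg hA) M.aemeasurable]
  simp only [Kernel.map_apply' _ hg _ hA]

omit [MeasurableSpace X] in
theorem abs_sum_sub_sum_le_of_neighbors {h : X → ℝ} {ε : ℝ} (h0 : ∀ x, 0 ≤ h x)
    (h1 : ∀ x, h x ≤ ε) {x x' : Fin n → X} (hxx' : Neighbors x x') :
    |∑ i, h (x i) - ∑ i, h (x' i)| ≤ ε := by
  obtain ⟨i, -, hi⟩ := hxx'
  rw [← Finset.sum_sub_distrib, Finset.sum_eq_single i]
  · rw [abs_le]
    constructor <;> linarith [h0 (x i), h1 (x i), h0 (x' i), h1 (x' i)]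
  · intro j _ hj
    have : x j = x' j := by
      by_contra hne
      exact hj (hi j hne)
    rw [this, sub_self]
  · simp

/-- Releasing the sum of `h` with Laplace noise and clipping it to its range loses only a
logarithmic term against the variational value of `h`. -/
theorem exists_isDP_integral_ge (P Q : Measure X) [IsProbabilityMeasure P]
    [IsProbabilityMeasure Q] {ε : ℝ} (hε : 0 ≤ ε) {h : X → ℝ} (hm : Measurable h)
    (h0 : ∀ x, 0 ≤ h x) (h1 : ∀ x, h x ≤ ε) (n : ℕ) :
    ∃ M : Kernel (Fin n → X) ℝ, ∃ _ : IsMarkovKernel M, IsDP ε M ∧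
      ∃ f : ℝ → ℝ, Measurable f ∧ (∃ C, ∀ y, |f y| ≤ C) ∧
        ∫ y, Real.exp (f y) ∂(outputLaw M P) ≤ 1 ∧
        n * (∫ x, h x ∂Q - Real.log (∫ x, Real.exp (h x) ∂P)) - ∫ z, |z| ∂laplace
          - Real.log (2 + n * ε) ≤ ∫ y, f y ∂(outputLaw M Q) := by
  set L : ℝ := n * ε with hL_def
  have hL : 0 ≤ L := by positivity
  have hhb : ∃ C, ∀ x, |h x| ≤ C :=
    ⟨ε, fun x => by rw [abs_of_nonneg (h0 x)]; exact h1 x⟩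
  set S : (Fin n → X) → ℝ := fun x => ∑ i, h (x i) with hS_def
  have hS : Measurable S := by fun_prop
  have hS0 : ∀ x, 0 ≤ S x := fun x => Finset.sum_nonneg fun i _ => h0 _
  have hS1 : ∀ x, S x ≤ L := fun x => by
    simpa [hS_def, hL_def] using Finset.sum_le_sum fun i (_ : i ∈ Finset.univ) => h1 (x i)
  have hSb : ∃ C, ∀ x, |S x| ≤ C :=
    ⟨L, fun x => by rw [abs_of_nonneg (hS0 x)]; exact hS1 x⟩
  set Λ := Real.log (∫ x, Real.exp (h x) ∂P) with hΛ
  have hΛpos := integral_exp_pos_of_abs_le hm hhb P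
  -- The first term normalises the exponential moment of S under P^n, the second that of the
  -- truncated noise. Without clipping, the Laplace exponential moment at 1 would be infinite.
  set b : ℝ := n * Λ + Real.log (2 + L) with hb_def
  set f : ℝ → ℝ := fun y => max 0 (min y L) - b with hf_def
  have hf : Measurable f := by fun_prop
  have hfb : ∃ C, ∀ y, |f y| ≤ C := ⟨L + |b|, fun y => by
    have h2 := clip_mem (r := y) hL
    refine (abs_sub _ _).trans ?_
    rw [abs_of_nonneg h2.1]
    gcongr
    exact h2.2⟩
  have hM := isMarkovKernel_laplaceMechanism hS
  refine ⟨laplaceMechanism S, hM, isDP_laplaceMechanism hS fun x x' hxx' =>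
    abs_sum_sub_sum_le_of_neighbors h0 h1 hxx', f, hf, hfb, ?_, ?_⟩
  · rw [integral_outputLaw _ P hf.exp (exists_abs_exp_le hfb)]
    have hx : ∀ x, ∫ y, Real.exp (f y) ∂(laplaceMechanism S x) ≤
        Real.exp (S x) * Real.exp (-(n * Λ)) := by
      intro x
      rw [integral_laplaceMechanism hS x hf.exp]
      have hpt : ∀ z, Real.exp (f (S x + z)) ≤
          Real.exp (S x - b) * Real.exp (min (max z 0) L) := by
        intro z
        rw [← Real.exp_add, Real.exp_le_exp]
        simp only [hf_def]
        have : max 0 (min (S x + z) L) ≤ S x + min (max z 0) L := by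
          rw [← min_add_add_left]
          refine max_le ?_ (le_min ?_ ?_)
          · exact le_min (add_nonneg (hS0 x) (le_max_right _ _)) (add_nonneg (hS0 x) hL)
          · exact (min_le_left _ _).trans (add_le_add_right (le_max_left _ _) _)
          · exact (min_le_right _ _).trans (le_add_of_nonneg_left (hS0 x))
        linarith
      have hi1 : Integrable (fun z => Real.exp (f (S x + z))) laplace :=
        integrable_of_measurable_of_abs_le (by fun_prop)
          (exists_abs_exp_le (hfb.imp fun C hC z => hC (S x + z))) _
      have hi2 : Integrable (fun z : ℝ => Real.exp (min (max z 0) L)) laplace :=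
        integrable_of_measurable_of_abs_le (by fun_prop)
          (exists_abs_exp_le ⟨L, fun z => by
            rw [abs_of_nonneg (le_min (le_max_right _ _) hL)]; exact min_le_right _ _⟩) _
      calc ∫ z, Real.exp (f (S x + z)) ∂laplace
          ≤ ∫ z, Real.exp (S x - b) * Real.exp (min (max z 0) L) ∂laplace :=
            integral_mono hi1 (hi2.const_mul _) hpt
        _ ≤ Real.exp (S x - b) * (2 + L) := by
            rw [integral_const_mul]
            gcongr
            exact integral_exp_min_laplace_le hL
        _ = Real.exp (S x) * Real.exp (-(n * Λ)) := by
            rw [← Real.exp_add, hb_def,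
              show S x - (n * Λ + Real.log (2 + L)) = (S x + -(n * Λ)) - Real.log (2 + L) by ring,
              Real.exp_sub, Real.exp_log (by linarith),
              div_mul_cancel₀ _ (by linarith : 2 + L ≠ 0)]
    have hprod : ∫ x, Real.exp (S x) ∂(iid n P) = Real.exp (n * Λ) := by
      simp only [hS_def, Real.exp_sum, iid]
      rw [integral_fintype_prod_eq_pow (fun x => Real.exp (h x)), Fintype.card_fin,
        Real.exp_nat_mul, hΛ, Real.exp_log hΛpos]
    have hSi : Integrable (fun x => Real.exp (S x)) (iid n P) :=
      integrable_of_measurable_of_abs_le hS.exp (exists_abs_exp_le hSb) _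
    calc ∫ x, ∫ y, Real.exp (f y) ∂(laplaceMechanism S x) ∂(iid n P)
        ≤ ∫ x, Real.exp (S x) * Real.exp (-(n * Λ)) ∂(iid n P) :=
          integral_mono_of_nonneg
            (ae_of_all _ fun x => integral_nonneg fun y => (Real.exp_pos _).le)
            (hSi.mul_const _) (ae_of_all _ hx)
      _ = 1 := by rw [integral_mul_const, hprod, ← Real.exp_add, add_neg_cancel, Real.exp_zero]
  · rw [integral_outputLaw _ Q hf hfb]
    have hx : ∀ x, S x - b - ∫ z, |z| ∂laplace ≤ ∫ y, f y ∂(laplaceMechanism S x) := by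
      intro x
      rw [integral_laplaceMechanism hS x hf]
      have hi1 : Integrable (fun z => f (S x + z)) laplace :=
        integrable_of_measurable_of_abs_le (by fun_prop) (hfb.imp fun C hC z => hC (S x + z)) _
      have hpt : ∀ z, S x - b - |z| ≤ f (S x + z) := by
        intro z
        -- Clipping is harmless from below because S already takes values in [0, L].
        have : S x - |z| ≤ max 0 (min (S x + z) L) := by
          refine le_max_of_le_right (le_min ?_ ?_)
          · linarith [neg_abs_le z]
          · linarith [abs_nonneg z, hS1 x]
        simp only [hf_def]
        linarith
      have := integral_mono ((integrable_const (S x - b)).sub integrable_abs_laplace) hi1 hpt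
      simp only [Pi.sub_apply] at this
      rw [integral_sub (integrable_const _) integrable_abs_laplace] at this
      simpa using this
    have hSi : Integrable S (iid n Q) := integrable_of_measurable_of_abs_le hS hSb _
    have hSQ : ∫ x, S x ∂(iid n Q) = n * ∫ x, h x ∂Q := by
      simp only [hS_def, iid]
      rw [integral_finsetSum]
      · simp only [integral_comp_eval (μ := fun _ : Fin n => Q) hm.aestronglyMeasurable]
        simp
      · intro i _
        exact integrable_of_measurable_of_abs_le (by fun_prop) (hhb.imp fun C hC x => hC (x i)) _
    have hfi : Integrable (fun x => ∫ y, f y ∂(laplaceMechanism S x)) (iid n Q) := by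
      refine integrable_of_measurable_of_abs_le
        (hf.stronglyMeasurable.integral_kernel (κ := laplaceMechanism S)).measurable
        (hfb.imp fun C hC x => ?_) _
      simpa using norm_integral_le_of_norm_le_const (μ := laplaceMechanism S x) (f := f)
        (ae_of_all _ hC)
    have := integral_mono ((hSi.sub (integrable_const b)).sub
      (integrable_const (∫ z, |z| ∂laplace))) hfi hx
    rw [integral_sub' (hSi.sub (integrable_const b)) (integrable_const _),
      integral_sub' hSi (integrable_const b), hSQ] at this
    simp only [integral_const, probReal_univ, one_smul] at this
    refine le_trans (le_of_eq ?_) this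
    rw [hb_def]
    ring

theorem expLog_map_exp (μ : Measure ℝ) {f : ℝ → ℝ} (hf : Measurable f) (hi : Integrable f μ) :
    expLog (μ.map fun y => (Real.exp (f y)).toNNReal) = ((∫ y, f y ∂μ : ℝ) : EReal) := by
  have hg : Measurable fun y => (Real.exp (f y)).toNNReal := by fun_prop
  have hlog : ∀ y, ENNReal.log ((Real.exp (f y)).toNNReal : ℝ≥0∞) = (f y : EReal) := fun y => by
    rw [ENNReal.log_of_nnreal (by simpa using Real.exp_pos _),
      Real.coe_toNNReal _ (Real.exp_pos _).le, Real.log_exp]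
  have hm1 : Measurable fun y : ℝ≥0 => (ENNReal.log (y : ℝ≥0∞)).toENNReal := by fun_prop
  have hm2 : Measurable fun y : ℝ≥0 => (-ENNReal.log (y : ℝ≥0∞)).toENNReal := by fun_prop
  rw [expLog, lintegral_map hm1 hg, lintegral_map hm2 hg]
  simp only [hlog, ← EReal.coe_neg, EReal.real_coe_toENNReal]
  have hp : ∫⁻ y, ENNReal.ofReal (f y) ∂μ ≠ ∞ := hi.lintegral_lt_top.ne
  have hn : ∫⁻ y, ENNReal.ofReal (-f y) ∂μ ≠ ∞ := hi.neg.lintegral_lt_top.ne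
  rw [integral_eq_lintegral_pos_part_sub_lintegral_neg_part hi, EReal.coe_sub,
    EReal.coe_ennreal_toReal hp, EReal.coe_ennreal_toReal hn]

/-- Donsker–Varadhan with test function f, whose log-moment term is nonpositive by `hE`. The real
output is lifted to the universe over which the supremum runs. -/
theorem ofReal_le_maxKLRate {P Q : Measure X} [IsProbabilityMeasure P] [IsProbabilityMeasure Q]
    {ε : ℝ} {M : Kernel (Fin n → X) ℝ} [IsMarkovKernel M] (hM : IsDP ε M) {f : ℝ → ℝ}
    (hf : Measurable f) (hb : ∃ C, ∀ y, |f y| ≤ C)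
    (hE : ∫ y, Real.exp (f y) ∂(outputLaw M P) ≤ 1) :
    ENNReal.ofReal (∫ y, f y ∂(outputLaw M Q)) / n ≤ maxKLRate.{_, v} ε Q P n := by
  have hup : Measurable (ULift.up.{v} : ℝ → ULift.{v} ℝ) := measurable_up
  have hmk : IsMarkovKernel (M.map (ULift.up.{v} : ℝ → ULift.{v} ℝ)) :=
    Kernel.IsMarkovKernel.map _ hup
  have hfd : Measurable fun y : ULift.{v} ℝ => f y.down := hf.comp measurable_down
  have hbd : ∃ C, ∀ y : ULift.{v} ℝ, |f y.down| ≤ C := hb.imp fun C hC y => hC _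
  refine le_trans ?_ (le_iSup_of_le (ULift.{v} ℝ) (le_iSup_of_le inferInstance
    (le_iSup_of_le (M.map ULift.up) (le_iSup_of_le hmk (le_iSup_of_le (hM.map hup) le_rfl)))))
  gcongr
  refine le_trans ?_ (ofReal_integral_sub_log_integral_exp_le_klDiv _ _
    (integrable_of_measurable_of_abs_le hfd hbd _)
    (integrable_of_measurable_of_abs_le hfd.exp (exists_abs_exp_le hbd) _))
  apply ENNReal.ofReal_le_ofReal
  rw [outputLaw_map M Q hup, outputLaw_map M P hup,
    integral_map hup.aemeasurable hfd.aestronglyMeasurable,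
    integral_map hup.aemeasurable hfd.exp.aestronglyMeasurable]
  have := Real.log_nonpos (integral_nonneg fun y => (Real.exp_pos (f y)).le) hE
  simp only
  linarith

/-- Post-processing by `e^f` preserves privacy and yields an e-variable by `hE`. -/
theorem coe_le_maxEPowerRate {P Q : Measure X} [IsProbabilityMeasure P] [IsProbabilityMeasure Q]
    {ε : ℝ} {M : Kernel (Fin n → X) ℝ} [IsMarkovKernel M] (hM : IsDP ε M) {f : ℝ → ℝ}
    (hf : Measurable f) (hb : ∃ C, ∀ y, |f y| ≤ C)
    (hE : ∫ y, Real.exp (f y) ∂(outputLaw M P) ≤ 1) :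
    ((∫ y, f y ∂(outputLaw M Q) : ℝ) : EReal) / n ≤ maxEPowerRate ε Q P n := by
  have hg : Measurable fun y => (Real.exp (f y)).toNNReal := by fun_prop
  refine le_trans ?_ (le_iSup₂_of_le (M.map fun y => (Real.exp (f y)).toNNReal)
    ⟨Kernel.IsMarkovKernel.map _ hg, hM.map hg, ?_⟩ le_rfl)
  · rw [outputLaw_map M Q hg, expLog_map_exp _ hf (integrable_of_measurable_of_abs_le hf hb _)]
  · rw [outputLaw_map M P hg, lintegral_map (by fun_prop) hg]
    change ∫⁻ y, ENNReal.ofReal (Real.exp (f y)) ∂(outputLaw M P) ≤ 1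
    rw [← ofReal_integral_eq_lintegral_ofReal
      (integrable_of_measurable_of_abs_le hf.exp (exists_abs_exp_le hb) _)
      (ae_of_all _ fun y => (Real.exp_pos _).le)]
    exact ENNReal.ofReal_le_one.2 hE

end Mechanism

/-! ### Passage to the limit -/

theorem tendsto_mul_sub_log_div {V κ ε : ℝ} (hε : 0 < ε) :
    Tendsto (fun n : ℕ => (n * V - κ - Real.log (2 + n * ε)) / n) atTop (𝓝 V) := by
  have h1 : Tendsto (fun n : ℕ => Real.log (2 + n * ε) / n) atTop (𝓝 0) := by
    have h2 := Real.tendsto_pow_log_div_mul_add_atTop ε⁻¹ (-2 * ε⁻¹) 1 (inv_ne_zero hε.ne')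
    have h3 : Tendsto (fun n : ℕ => 2 + n * ε) atTop atTop :=
      tendsto_atTop_add_const_left _ _ (tendsto_natCast_atTop_atTop.atTop_mul_const hε)
    refine (h2.comp h3).congr fun n => ?_
    simp only [Function.comp_apply, pow_one]
    congr 1
    field_simp
    ring
  have h2 : Tendsto (fun n : ℕ => κ / (n : ℝ)) atTop (𝓝 0) := tendsto_const_div_atTop_nhds_zero_nat κ
  have h3 := (h2.const_sub V).sub h1
  simp only [sub_zero] at h3
  refine h3.congr' ?_
  filter_upwards [eventually_ne_atTop 0] with n hn
  have : (n : ℝ) ≠ 0 := by exact_mod_cast hn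
  field_simp

end DPDuality

theorem mainTheorem1 {X : Type u} [MeasurableSpace X] (P Q : Measure X)
    [IsProbabilityMeasure P] [IsProbabilityMeasure Q] (ε : ℝ) (hε : 0 < ε) :
    Tendsto (fun n : ℕ => DPDuality.maxKLRate.{u, v} ε Q P n) atTop
        (𝓝 (DPDuality.dualValue ε Q P)) ∧
      Tendsto (fun n : ℕ => DPDuality.maxEPowerRate ε Q P n) atTop
        (𝓝 ((DPDuality.dualValue ε Q P : ℝ≥0∞) : EReal)) := by
  open DPDuality in
  obtain ⟨h, hm, h0, h1, hV0, hV⟩ := exists_dualValue_le P Q hε.le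
  set V := ∫ x, h x ∂Q - Real.log (∫ x, Real.exp (h x) ∂P) with hV_def
  set a : ℕ → ℝ := fun n => (n * V - ∫ z, |z| ∂laplace - Real.log (2 + n * ε)) / n with ha
  have hlim : Tendsto a atTop (𝓝 V) := tendsto_mul_sub_log_div hε
  have hKL : ∀ᶠ n : ℕ in atTop, ENNReal.ofReal (a n) ≤ maxKLRate.{u, v} ε Q P n := by
    filter_upwards [eventually_gt_atTop 0] with n hn
    have hn' : (0 : ℝ) < n := by exact_mod_cast hn
    obtain ⟨M, _, hM, f, hf, hb, hE, hge⟩ := exists_isDP_integral_ge P Q hε.le hm h0 h1 n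
    refine le_trans ?_ (ofReal_le_maxKLRate (Q := Q) hM hf hb hE)
    rw [ha, ENNReal.ofReal_div_of_pos hn', ENNReal.ofReal_natCast]
    gcongr
  have hEP : ∀ᶠ n : ℕ in atTop, (a n : EReal) ≤ maxEPowerRate ε Q P n := by
    filter_upwards with n
    obtain ⟨M, _, hM, f, hf, hb, hE, hge⟩ := exists_isDP_integral_ge P Q hε.le hm h0 h1 n
    refine le_trans ?_ (coe_le_maxEPowerRate (Q := Q) hM hf hb hE)
    rw [ha, EReal.coe_div]
    exact EReal.div_le_div_right_of_nonneg (by exact_mod_cast Nat.cast_nonneg n)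
      (EReal.coe_le_coe_iff.2 hge)
  -- The missing inequality V ≤ D comes from the mechanisms themselves: their rates tend to V and
  -- never exceed D.
  have hDV : dualValue ε Q P = ENNReal.ofReal V := by
    refine le_antisymm hV (le_of_tendsto (ENNReal.tendsto_ofReal hlim) ?_)
    filter_upwards [hKL] with n hn
    exact hn.trans (maxKLRate_le_dualValue P Q hε.le n)
  constructor
  · refine tendsto_of_tendsto_of_tendsto_of_le_of_le' (hDV ▸ ENNReal.tendsto_ofReal hlim)
      tendsto_const_nhds hKL (Eventually.of_forall fun n => maxKLRate_le_dualValue P Q hε.le n)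
  · refine tendsto_of_tendsto_of_tendsto_of_le_of_le' ?_ tendsto_const_nhds hEP ?_
    · rw [hDV, EReal.coe_ennreal_ofReal, max_eq_left hV0]
      exact (continuous_coe_real_ereal.tendsto V).comp hlim
    · filter_upwards [eventually_ne_atTop 0] with n hn
      exact maxEPowerRate_le_dualValue P Q hε.le hn
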